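/- Let $n\ge 1$. A complex Lie algebra of dimension $n$ is identified with its product $\mu$ on $\mathbb{C}^n$, that is, with the point $(C_{ij}^k)\in\mathbb{C}^{n^3}$ of its structure constants, $\mu(e_i,e_j)=\sum_k C_{ij}^k e_k$; let $L^n\subset\mathbb{C}^{n^3}$ be the set of all of them. The orbit $\mathcal{O}(\mu)$ of $\mu\in L^n$ is the set of all products $f^{-1}(\mu(f(X),f(Y)))$ with $f\in GL(n,\mathbb{C})$. One says that $\mu$ contracts onto $\mu_0$ if $\mu_0$ lies in the closure $\overline{\mathcal{O}(\mu)}$, taken in the Zariski topology of $\mathbb{C}^{n^3}$; metric contraction is defined in the same way with the usual topology of $\mathbb{C}^{n^3}$. For a linear form $\omega$ on a Lie algebra, $d\omega$ is the exterior $2$-form $d\omega(X,Y)=\omega([X,Y])$. A Lie algebra of dimension $2p$ is called Frobeniusian if there is a linear form $\omega\neq 0$ on it with $(d\omega)^p\neq 0$ (so that $d\omega$ is an exact symplectic form). Let $p\ge 1$. For $\varphi=(\varphi_1,\dots,\varphi_{p-1})\in\mathbb{C}^{p-1}$ let $F_\varphi$ be the algebra structure on $\mathbb{C}^{2p}$ given,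 in the basis $\omega_1,\dots,\omega_{2p}$ of $(\mathbb{C}^{2p})^*$ dual to the standard basis, by the Maurer–Cartan equations $$d\omega_1=\omega_1\wedge\omega_2+\sum_{k=1}^{p-1}\omega_{2k+1}\wedge\omega_{2k+2},\qquad d\omega_2=0,$$ $$d\omega_{2k+1}=\varphi_k\,\omega_2\wedge\omega_{2k+1},\qquad d\omega_{2k+2}=-(1+\varphi_k)\,\omega_2\wedge\omega_{2k+2}\qquad(1\le k\le p-1).$$ Theorem. The family $\{F_\varphi\}_{\varphi\in\mathbb{C}^{p-1}}$ is an irreducible model for the property "there is an exact symplectic form", that is: 1. every $F_\varphi$ is a Lie algebra, and it is Frobeniusian; 2. every Frobeniusian complex Lie algebra of dimension $2p$ contracts onto some $F_\varphi$; 3. there is no contraction between two distinct members of the family: if $F_\varphi$ and $F_{\varphi'}$ are not isomorphic, then $F_\varphi$ does not contract onto $F_{\varphi'}$. All of this holds for contraction (Zariski closure) and also for metric contraction (closure in the usual topology). -/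

import Mathlib

noncomputable section

namespace LieVar

/-- Families of structure constants `C (i, j, k) = C_{ij}^k`, i.e. the affine space `ℂ^{n³}`. -/
abbrev StructureConstants (n : ℕ) : Type := Fin n × Fin n × Fin n → ℂ

/-- The bilinear product `μ` on `ℂⁿ` with `μ(e_i, e_j) = ∑ₖ C_{ij}^k e_k`. -/
def bracket {n : ℕ} (C : StructureConstants n) (x y : Fin n → ℂ) : Fin n → ℂ :=
  fun k => ∑ i, ∑ j, x i * y j * C (i, j, k)

/-- The variety `Lⁿ` of complex Lie algebra structures on `ℂⁿ`. -/
def lieVariety (n : ℕ) : Set (StructureConstants n) :=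
  {C | (∀ x, bracket C x x = 0) ∧
    ∀ x y z, bracket C (bracket C x y) z + bracket C (bracket C y z) x
      + bracket C (bracket C z x) y = 0}

/-- The product `f ∗ μ (X, Y) = f⁻¹ (μ (f X, f Y))`, given by its structure constants. -/
def act {n : ℕ} (f : (Fin n → ℂ) ≃ₗ[ℂ] (Fin n → ℂ)) (C : StructureConstants n) :
    StructureConstants n :=
  fun t => f.symm (bracket C (f (Pi.single t.1 1)) (f (Pi.single t.2.1 1))) t.2.2

/-- The orbit of a product under the linear group `GL(n, ℂ)`. -/
def orbit {n : ℕ} (C : StructureConstants n) : Set (StructureConstants n) :=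
  Set.range fun f : (Fin n → ℂ) ≃ₗ[ℂ] (Fin n → ℂ) => act f C

/-- Isomorphism of the Lie algebras `(ℂⁿ, C)` and `(ℂⁿ, C')`. -/
def Isomorphic {n : ℕ} (C C' : StructureConstants n) : Prop :=
  ∃ f : (Fin n → ℂ) ≃ₗ[ℂ] (Fin n → ℂ), ∀ x y, f (bracket C x y) = bracket C' (f x) (f y)

/-- `C` contracts onto `C₀`: the point `C₀` lies in the Zariski closure of the orbit of `C`. -/
def ContractsTo {n : ℕ} (C C₀ : StructureConstants n) : Prop :=
  C₀ ∈ MvPolynomial.zeroLocus ℂ (MvPolynomial.vanishingIdeal ℂ (orbit C))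

/-- `C` contracts onto `C₀` for the metric topology: the point `C₀` lies in the closure of the
orbit of `C` for the usual topology of `ℂ^{n³}`. -/
def MetricContractsTo {n : ℕ} (C C₀ : StructureConstants n) : Prop :=
  C₀ ∈ closure (orbit C)

/-- Exterior forms on `ℂⁿ`, as elements of the exterior algebra of the dual space. -/
abbrev Forms (n : ℕ) : Type := ExteriorAlgebra ℂ (Module.Dual ℂ (Fin n → ℂ))

/-- A linear form, viewed as an exterior form of degree one. -/
abbrev oneForm {n : ℕ} (ω : Module.Dual ℂ (Fin n → ℂ)) : Forms n :=
  ExteriorAlgebra.ι ℂ ω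

/-- The elements of the basis of `(ℂⁿ)*` dual to the standard basis. -/
abbrev coordForm {n : ℕ} (i : Fin n) : Module.Dual ℂ (Fin n → ℂ) := LinearMap.proj i

/-- The differential of a linear form: the exterior `2`-form `dω (X, Y) = ω (μ (X, Y))`, written
`∑_{i < j} ω (μ (e_i, e_j)) ω_i ∧ ω_j` in the dual basis. -/
def d {n : ℕ} (C : StructureConstants n) (ω : Module.Dual ℂ (Fin n → ℂ)) : Forms n :=
  ∑ i, ∑ j ∈ Finset.Ioi i, ω (bracket C (Pi.single i 1) (Pi.single j 1)) •
    (oneForm (coordForm i) * oneForm (coordForm j))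

/-- A Lie algebra structure on `ℂ^{2p}` is Frobeniusian if there is a nonzero linear form `ω` with
`(dω)^p ≠ 0` (exterior power). -/
def IsFrobeniusian {p : ℕ} (C : StructureConstants (2 * p)) : Prop :=
  ∃ ω : Module.Dual ℂ (Fin (2 * p) → ℂ), ω ≠ 0 ∧ d C ω ^ p ≠ 0

/-- The coefficient `(ω_a ∧ ω_b)(e_i, e_j)`. -/
def wedgeCoeff (a b i j : ℕ) : ℂ :=
  (if i = a ∧ j = b then 1 else 0) - (if i = b ∧ j = a then 1 else 0)

/-- The algebra `F_φ` of dimension `2p`. Indices start at `0` here: the form called `ω_m` in the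
usual numbering `1, …, 2p` has index `m - 1`, and `φ_{k+1}` is `φ k`. So `dω_1` is the form of
index `0`, `dω_2 = 0` the one of index `1`, and the pair attached to `φ k` has the indices
`2k + 2` and `2k + 3`. -/
def frobeniusModel (p : ℕ) (φ : Fin (p - 1) → ℂ) : StructureConstants (2 * p) :=
  fun (i, j, m) =>
    if (m : ℕ) = 0 then
      wedgeCoeff 0 1 i j + ∑ k : Fin (p - 1), wedgeCoeff (2 * k + 2) (2 * k + 3) i j
    else
      ∑ k : Fin (p - 1),
        ((if (m : ℕ) = 2 * k + 2 then φ k * wedgeCoeff 1 (2 * k + 2) i j else 0) +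
          (if (m : ℕ) = 2 * k + 3 then -(1 + φ k) * wedgeCoeff 1 (2 * k + 3) i j else 0))

theorem bracket_single {n : ℕ} (C : StructureConstants n) (i j k : Fin n) :
    bracket C (Pi.single i 1) (Pi.single j 1) k = C (i, j, k) := by
  simp [bracket, Pi.single_apply]

theorem sum_wedgeCoeff {n : ℕ} (a b : Fin n) (h : a < b) (c : ℂ) (X : Fin n → Fin n → Forms n) :
    ∑ i : Fin n, ∑ j ∈ Finset.Ioi i, (c * wedgeCoeff a b i j) • X i j = c • X a b := by
  rw [Finset.sum_eq_single a, Finset.sum_eq_single b]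
  · have : (a : ℕ) ≠ b := by have := Fin.lt_def.1 h; omega
    simp [wedgeCoeff, this]
  · intro j hj hjb
    have h1 : (j : ℕ) ≠ b := fun e => hjb (Fin.ext e)
    have : (a : ℕ) ≠ b := by have := Fin.lt_def.1 h; omega
    simp [wedgeCoeff, h1, this]
  · intro h'; simp [h] at h'
  · intro i _ hia
    refine Finset.sum_eq_zero fun j hj => ?_
    have hij := Fin.lt_def.1 (Finset.mem_Ioi.1 hj)
    have h1 : (i : ℕ) ≠ a := fun e => hia (Fin.ext e)
    have h2 : ¬ ((i : ℕ) = b ∧ (j : ℕ) = a) := by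
      rintro ⟨e1, e2⟩; have := Fin.lt_def.1 h; omega
    simp [wedgeCoeff, h1, h2]
  · simp

theorem d_coordForm {n : ℕ} (C : StructureConstants n) (m : Fin n) :
    d C (coordForm m) = ∑ i, ∑ j ∈ Finset.Ioi i, C (i, j, m) •
      (oneForm (coordForm i) * oneForm (coordForm j)) := by
  simp [d, bracket_single]

/-- The Maurer-Cartan equations of `F_φ` (indices shifted by one). -/
theorem frobeniusModel_maurerCartan (p : ℕ) (hp : 1 ≤ p) (φ : Fin (p - 1) → ℂ) :
    let ω : Fin (2 * p) → Forms (2 * p) := fun i => oneForm (coordForm i)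
    let dω : Fin (2 * p) → Forms (2 * p) := fun i => d (frobeniusModel p φ) (coordForm i)
    dω ⟨0, by omega⟩ = ω ⟨0, by omega⟩ * ω ⟨1, by omega⟩ +
        ∑ k : Fin (p - 1), ω ⟨2 * k + 2, by omega⟩ * ω ⟨2 * k + 3, by omega⟩ ∧
    dω ⟨1, by omega⟩ = 0 ∧
    (∀ k : Fin (p - 1), dω ⟨2 * k + 2, by omega⟩ =
        φ k • (ω ⟨1, by omega⟩ * ω ⟨2 * k + 2, by omega⟩)) ∧
    ∀ k : Fin (p - 1), dω ⟨2 * k + 3, by omega⟩ =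
        (-(1 + φ k)) • (ω ⟨1, by omega⟩ * ω ⟨2 * k + 3, by omega⟩) := by
  intro ω dω
  have key (a b : ℕ) (ha : a < 2 * p) (hb : b < 2 * p) (h : a < b) (c : ℂ) :
      ∑ i : Fin (2 * p), ∑ j ∈ Finset.Ioi i, (c * wedgeCoeff a b i j) • (ω i * ω j)
        = c • (ω ⟨a, ha⟩ * ω ⟨b, hb⟩) :=
    sum_wedgeCoeff (n := 2 * p) ⟨a, ha⟩ ⟨b, hb⟩ h c (fun i j => ω i * ω j)
  refine ⟨?_, ?_, fun k => ?_, fun k => ?_⟩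
  · simp only [dω, d_coordForm, frobeniusModel, if_true, add_smul, Finset.sum_smul,
      Finset.sum_add_distrib]
    congr 1
    · simpa using key 0 1 (by omega) (by omega) (by omega) 1
    · have : ∀ i : Fin (2 * p), ∑ j ∈ Finset.Ioi i, ∑ k : Fin (p - 1),
          wedgeCoeff (2 * k + 2) (2 * k + 3) i j • (oneForm (coordForm i) * oneForm (coordForm j))
          = ∑ k : Fin (p - 1), ∑ j ∈ Finset.Ioi i,
          wedgeCoeff (2 * k + 2) (2 * k + 3) i j • (oneForm (coordForm i) * oneForm (coordForm j)) :=
        fun i => Finset.sum_comm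
      rw [Finset.sum_congr rfl fun i _ => this i, Finset.sum_comm]
      refine Finset.sum_congr rfl fun k _ => ?_
      simpa using key (2 * k + 2) (2 * k + 3) (by omega) (by omega) (by omega) 1
  · simp only [dω, d_coordForm, frobeniusModel]
    refine Finset.sum_eq_zero fun i _ => Finset.sum_eq_zero fun j _ => ?_
    rw [if_neg (by simp), Finset.sum_eq_zero, zero_smul]
    intro k _
    rw [if_neg (by omega), if_neg (by omega), add_zero]
  · simp only [dω, d_coordForm]
    rw [← key 1 (2 * k + 2) (by omega) (by omega) (by omega) (φ k)]
    refine Finset.sum_congr rfl fun i _ => Finset.sum_congr rfl fun j _ => ?_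
    congr 1
    simp only [frobeniusModel]
    rw [if_neg (by omega), Finset.sum_eq_single k]
    · rw [if_pos rfl, if_neg (by omega), add_zero]
    · intro l _ hl
      have : (l : ℕ) ≠ k := fun e => hl (Fin.ext e)
      rw [if_neg (by omega), if_neg (by omega), add_zero]
    · simp
  · simp only [dω, d_coordForm]
    rw [← key 1 (2 * k + 3) (by omega) (by omega) (by omega) (-(1 + φ k))]
    refine Finset.sum_congr rfl fun i _ => Finset.sum_congr rfl fun j _ => ?_
    congr 1
    simp only [frobeniusModel]
    rw [if_neg (by omega), Finset.sum_eq_single k]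
    · rw [if_neg (by omega), if_pos rfl, zero_add]
    · intro l _ hl
      have : (l : ℕ) ≠ k := fun e => hl (Fin.ext e)
      rw [if_neg (by omega), if_neg (by omega), add_zero]
    · simp

/-- For a notion of contraction `contracts C C₀` (`C` contracts onto `C₀`), a family of Lie
algebras is an irreducible model for the property `P` if all its members have the property,
every Lie algebra with the property contracts onto some member, and there is no contraction
between two distinct (that is, non-isomorphic) members. -/
def IsIrreducibleModel {n : ℕ} {ι : Type*}
    (contracts : StructureConstants n → StructureConstants n → Prop)
    (P : StructureConstants n → Prop) (F : ι → StructureConstants n) : Prop :=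
  (∀ i, F i ∈ lieVariety n ∧ P (F i)) ∧
  (∀ C ∈ lieVariety n, P C → ∃ i, contracts C (F i)) ∧
  ∀ i j, ¬ Isomorphic (F i) (F j) → ¬ contracts (F i) (F j)

end LieVar

end

/-! Existence. Let `ω` make `σ = dω` nondegenerate. Choose `e₂` with `ω = σ(·, e₂)` and `e₁` with
`ω(e₁) = 1`, so that `(e₁, e₂)` is a hyperbolic pair. Applying `ω` to the Jacobi identity shows that
`β(x, y) = σ([e₂, x], y)` satisfies `β(x, y) = β(y, x) - σ(x, y)`. Such a form can be made
triangular in a symplectic basis `u, w` of the orthogonal of the pair (`exists_isAdaptedBasis`).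
Rescaling the basis vectors by suitable powers of `t` and letting `t → 0` kills every remaining
constant foreign to the model (`metricContractsTo_of_weights`); the limit is `F_φ` with `φ_i =
β(u_i, w_i)`.

Rigidity. On `F_φ`, `det (s tr(ad x) + p ad x) = a(s) tr(ad x)^(2p)` for all `x`, where `a(s) =
s(1+s) ∏ (s(1+s) - φ_k(1+φ_k))`. This identity is polynomial in the structure constants and,
required for all `x`, invariant under `GL`, so it survives in the Zariski closure
(`ContractsTo.adDet_eq`). A contraction therefore preserves the multiset of the `φ_k(1+φ_k)`, and
this multiset determines `F_φ` up to isomorphism (`isomorphic_frobeniusModel`).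

The metric closure lies in the Zariski closure, so it is enough to prove existence for the former
and rigidity for the latter. -/

noncomputable section

namespace LieVar

open Module

/-! ### The bracket as a bilinear map -/

section Bracket

variable {n : ℕ} (C : StructureConstants n)

/-- The product of a family of structure constants as a bilinear map. -/
def bracketLin : (Fin n → ℂ) →ₗ[ℂ] (Fin n → ℂ) →ₗ[ℂ] (Fin n → ℂ) :=
  LinearMap.mk₂ ℂ (bracket C)
    (fun x y z => by
      ext k; simp only [bracket, Pi.add_apply, ← Finset.sum_add_distrib, add_mul])
    (fun c x y => by
      ext k; simp only [bracket, Pi.smul_apply, smul_eq_mul, Finset.mul_sum, mul_assoc])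
    (fun x y z => by
      ext k; simp only [bracket, Pi.add_apply, ← Finset.sum_add_distrib, add_mul, mul_add])
    (fun c x y => by
      ext k
      simp only [bracket, Pi.smul_apply, smul_eq_mul, Finset.mul_sum]
      refine Finset.sum_congr rfl fun i _ => Finset.sum_congr rfl fun j _ => by ring)

@[simp] theorem bracketLin_apply (x y : Fin n → ℂ) : bracketLin C x y = bracket C x y := rfl

theorem bracket_swap (hC : ∀ x, bracket C x x = 0) (x y : Fin n → ℂ) :
    bracket C y x = -bracket C x y := by
  have h := hC (x + y)
  simp only [← bracketLin_apply, map_add, LinearMap.add_apply] at h hC ⊢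
  rw [hC, hC] at h
  rw [eq_neg_iff_add_eq_zero]
  simpa using h

end Bracket

/-! ### Indices of the model algebras -/

/-- Indices of a basis of a `2 (q + 1)`-dimensional space: two distinguished ones, and `q` pairs. -/
abbrev PairIndex (q : ℕ) : Type := Bool ⊕ (Fin q ⊕ Fin q)

/-- The position of a basis vector of `F_φ` in the usual numbering. -/
def position (p : ℕ) (hp : 1 ≤ p) : PairIndex (p - 1) → Fin (2 * p)
  | .inl false => ⟨0, by omega⟩
  | .inl true => ⟨1, by omega⟩
  | .inr (.inl k) => ⟨2 * k + 2, by omega⟩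
  | .inr (.inr k) => ⟨2 * k + 3, by omega⟩

theorem position_bijective (p : ℕ) (hp : 1 ≤ p) : Function.Bijective (position p hp) := by
  constructor
  · rintro ((_ | _) | (i | i)) ((_ | _) | (j | j)) h <;> simp [position] at h ⊢ <;> omega
  · intro m
    rcases Nat.lt_or_ge m 2 with h | h
    · rcases Nat.lt_or_ge m 1 with h' | h'
      · exact ⟨.inl false, by ext; simp [position]; omega⟩
      · exact ⟨.inl true, by ext; simp [position]; omega⟩
    · rcases Nat.even_or_odd' (m : ℕ) with ⟨k, hk | hk⟩
      · exact ⟨.inr (.inl ⟨k - 1, by omega⟩), by ext; simp [position]; omega⟩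
      · exact ⟨.inr (.inr ⟨k - 1, by omega⟩), by ext; simp [position]; omega⟩

/-- The numbering of the basis of `F_φ`. -/
def numbering (p : ℕ) (hp : 1 ≤ p) : PairIndex (p - 1) ≃ Fin (2 * p) :=
  Equiv.ofBijective _ (position_bijective p hp)

/-- The structure constants of `F_φ`, indexed by pairs. -/
def pairModel {q : ℕ} (φ : Fin q → ℂ) : PairIndex q → PairIndex q → PairIndex q → ℂ
  | .inl false, .inl true, .inl false => 1
  | .inl true, .inl false, .inl false => -1
  | .inr (.inl i), .inr (.inr j), .inl false => if i = j then 1 else 0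
  | .inr (.inr i), .inr (.inl j), .inl false => if i = j then -1 else 0
  | .inl true, .inr (.inl i), .inr (.inl j) => if i = j then φ i else 0
  | .inr (.inl i), .inl true, .inr (.inl j) => if i = j then -φ i else 0
  | .inl true, .inr (.inr i), .inr (.inr j) => if i = j then -(1 + φ i) else 0
  | .inr (.inr i), .inl true, .inr (.inr j) => if i = j then 1 + φ i else 0
  | _, _, _ => 0

theorem frobeniusModel_numbering (p : ℕ) (hp : 1 ≤ p) (φ : Fin (p - 1) → ℂ)
    (i j m : PairIndex (p - 1)) :
    frobeniusModel p φ (numbering p hp i, numbering p hp j, numbering p hp m) =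
      pairModel φ i j m := by
  have h1 (a b : ℕ) : ¬ 2 * a = 2 * b + 1 := by omega
  have h2 (a b : ℕ) : ¬ 2 * a + 3 = 2 * b + 2 := by omega
  have h5 (a b : Fin (p - 1)) (c : ℂ) :
      (∑ x, if a = x ∧ b = x then c else 0) = if a = b then c else 0 := by
    rw [Finset.sum_eq_single a] <;> grind
  rcases i with (_ | _) | (i | i) <;> rcases j with (_ | _) | (j | j) <;>
    rcases m with (_ | _) | (m | m) <;>
    simp [numbering, position, frobeniusModel, wedgeCoeff, pairModel, h1, h2, Fin.val_inj,
      h5, Finset.sum_ite_eq]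
  all_goals grind

section Model

variable {p : ℕ} (hp : 1 ≤ p) (φ : Fin (p - 1) → ℂ)

theorem bracket_frobeniusModel (x y : Fin (2 * p) → ℂ) (m : PairIndex (p - 1)) :
    bracket (frobeniusModel p φ) x y (numbering p hp m) =
      ∑ i, ∑ j, x (numbering p hp i) * y (numbering p hp j) * pairModel φ i j m := by
  simp only [bracket, ← (numbering p hp).sum_comp, frobeniusModel_numbering]

/-- Coordinates of a vector on the basis of `F_φ`, indexed by pairs. -/
def pairCoord (x : Fin (2 * p) → ℂ) : PairIndex (p - 1) → ℂ := x ∘ numbering p hp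

theorem pairCoord_bracket_center (x y : Fin (2 * p) → ℂ) :
    pairCoord hp (bracket (frobeniusModel p φ) x y) (.inl false) =
      pairCoord hp x (.inl false) * pairCoord hp y (.inl true) -
        pairCoord hp x (.inl true) * pairCoord hp y (.inl false) +
      ∑ k, (pairCoord hp x (.inr (.inl k)) * pairCoord hp y (.inr (.inr k)) -
        pairCoord hp x (.inr (.inr k)) * pairCoord hp y (.inr (.inl k))) := by
  simp only [pairCoord, Function.comp, bracket_frobeniusModel]
  simp [Fintype.sum_sum_type, pairModel, Finset.sum_sub_distrib]
  ring

theorem pairCoord_bracket_grading (x y : Fin (2 * p) → ℂ) :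
    pairCoord hp (bracket (frobeniusModel p φ) x y) (.inl true) = 0 := by
  simp only [pairCoord, Function.comp, bracket_frobeniusModel]
  simp [pairModel]

theorem pairCoord_bracket_left (x y : Fin (2 * p) → ℂ) (k : Fin (p - 1)) :
    pairCoord hp (bracket (frobeniusModel p φ) x y) (.inr (.inl k)) =
      φ k * (pairCoord hp x (.inl true) * pairCoord hp y (.inr (.inl k)) -
        pairCoord hp x (.inr (.inl k)) * pairCoord hp y (.inl true)) := by
  simp only [pairCoord, Function.comp, bracket_frobeniusModel]
  simp [Fintype.sum_sum_type, pairModel]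
  ring

theorem pairCoord_bracket_right (x y : Fin (2 * p) → ℂ) (k : Fin (p - 1)) :
    pairCoord hp (bracket (frobeniusModel p φ) x y) (.inr (.inr k)) =
      -(1 + φ k) * (pairCoord hp x (.inl true) * pairCoord hp y (.inr (.inr k)) -
        pairCoord hp x (.inr (.inr k)) * pairCoord hp y (.inl true)) := by
  simp only [pairCoord, Function.comp, bracket_frobeniusModel]
  simp [Fintype.sum_sum_type, pairModel]
  ring

theorem pairCoord_injective : Function.Injective (pairCoord hp) := fun x y h => by
  ext m
  obtain ⟨i, rfl⟩ := (numbering p hp).surjective m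
  exact congrFun h i

theorem pairCoord_add (x y : Fin (2 * p) → ℂ) (i : PairIndex (p - 1)) :
    pairCoord hp (x + y) i = pairCoord hp x i + pairCoord hp y i := rfl

theorem pairCoord_zero (i : PairIndex (p - 1)) : pairCoord hp 0 i = 0 := rfl

end Model

theorem frobeniusModel_mem_lieVariety (p : ℕ) (hp : 1 ≤ p) (φ : Fin (p - 1) → ℂ) :
    frobeniusModel p φ ∈ lieVariety (2 * p) := by
  refine ⟨fun x => pairCoord_injective hp <| funext ?_, fun x y z =>
    pairCoord_injective hp <| funext ?_⟩
  · rintro ((_ | _) | (k | k)) <;>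
      simp only [pairCoord_bracket_center, pairCoord_bracket_grading, pairCoord_bracket_left,
        pairCoord_bracket_right, pairCoord_zero]
    · rw [Finset.sum_eq_zero fun k _ => by ring]; ring
    · ring
    · ring
  · rintro ((_ | _) | (k | k)) <;>
      simp only [pairCoord_bracket_center, pairCoord_bracket_grading, pairCoord_bracket_left,
        pairCoord_bracket_right, pairCoord_zero, pairCoord_add]
    · simp only [add_mul, zero_mul, sub_zero, Finset.sum_mul]
      -- The terms outside the sums cancel among themselves, and the six sums cancel index by index
      -- because `φ k - (1 + φ k) = -1` is the weight of `e₁`.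
      have (a b c s t r s' t' r' : ℂ) (h : a + b + c = 0) (h' : s + t + r + s' + t' + r' = 0) :
          a + s + s' + (b + t + t') + (c + r + r') = 0 := by linear_combination h + h'
      refine this _ _ _ _ _ _ _ _ _ (by ring) ?_
      simp only [← Finset.sum_add_distrib]
      exact Finset.sum_eq_zero fun k _ => by ring
    · ring
    · ring
    · ring

/-! ### Powers of exterior two-forms -/

section Powers

variable {A : Type*} [Ring A]

/-- Since `a m` commutes with the partial sum `s` and squares to zero, the binomial expansion of `(s
+ a m)^(l+1)` stops after the linear term. The two claims are proved together because the vanishing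
of `s^(m+1)` removes the other term. -/
theorem sum_pow_of_commute_of_sq_eq_zero (a : ℕ → A) (hc : ∀ i j, Commute (a i) (a j))
    (h : ∀ i, a i * a i = 0) (m : ℕ) :
    (∑ k ∈ Finset.range m, a k) ^ (m + 1) = 0 ∧
      (∑ k ∈ Finset.range m, a k) ^ m = m.factorial • ((List.range m).map a).prod := by
  induction m with
  | zero => simp
  | succ m ih =>
    obtain ⟨ih0, ih1⟩ := ih
    set s := ∑ k ∈ Finset.range m, a k
    have hs : Commute s (a m) := Commute.sum_left _ _ _ fun i _ => hc i m
    have key (l : ℕ) : (s + a m) ^ (l + 1) = s ^ (l + 1) + (l + 1) • (s ^ l * a m) := by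
      induction l with
      | zero => simp
      | succ l ihl =>
        have e1 : s ^ (l + 1) * a m = s ^ l * a m * s := by
          rw [pow_succ, mul_assoc, hs.eq, mul_assoc]
        have e2 : s ^ l * a m * a m = 0 := by rw [mul_assoc, h, mul_zero]
        rw [pow_succ, ihl, add_mul, mul_add, mul_add, smul_mul_assoc, smul_mul_assoc, e2, ← e1,
          ← pow_succ, smul_zero, add_zero, add_assoc, succ_nsmul' _ (l + 1)]
    rw [Finset.sum_range_succ]
    refine ⟨?_, ?_⟩
    · rw [key, pow_succ, ih0, zero_mul, zero_mul, smul_zero, add_zero]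
    · rw [key, ih0, ih1, zero_add, List.range_succ, List.map_append, List.prod_append,
        Nat.factorial_succ, mul_smul, smul_mul_assoc]
      simp

theorem prod_map_range_two_mul {M : Type*} [Monoid M] (f : ℕ → M) (m : ℕ) :
    ((List.range (2 * m)).map f).prod =
      ((List.range m).map fun k => f (2 * k) * f (2 * k + 1)).prod := by
  induction m with
  | zero => simp
  | succ m ih =>
    rw [show 2 * (m + 1) = 2 * m + 1 + 1 by ring, List.range_succ, List.range_succ]
    simp [List.range_succ, ih]

end Powers

section Exterior

variable {V : Type*} [AddCommGroup V] [Module ℂ V]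

open ExteriorAlgebra in
theorem ι_mul_ι_comm (a b : V) : ι ℂ a * ι ℂ b = -(ι ℂ b * ι ℂ a) :=
  eq_neg_of_add_eq_zero_left (ι_add_mul_swap a b)

open ExteriorAlgebra in
theorem commute_ι_mul_ι (a b c d : V) : Commute (ι ℂ a * ι ℂ b) (ι ℂ c * ι ℂ d) := by
  have h (x : V) : Commute (ι ℂ a * ι ℂ b) (ι ℂ x) := by
    rw [Commute, SemiconjBy, mul_assoc, ι_mul_ι_comm b x, mul_neg, ← mul_assoc, ι_mul_ι_comm a x,
      neg_mul, neg_neg, mul_assoc]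
  exact (h c).mul_right (h d)

open ExteriorAlgebra in
theorem ι_mul_ι_sq (a b : V) : ι ℂ a * ι ℂ b * (ι ℂ a * ι ℂ b) = 0 := by
  rw [← mul_assoc, mul_assoc (ι ℂ a), ι_mul_ι_comm b a, mul_neg, ← mul_assoc, ι_sq_zero, zero_mul,
    neg_zero, zero_mul]

/-- The determinant in the basis `b` extends to a linear form on the exterior algebra, with value
`1` on this element. -/
theorem ιMulti_basis_ne_zero {n : ℕ} (b : Basis (Fin n) ℂ V) : ExteriorAlgebra.ιMulti ℂ n b ≠ 0 := by
  intro h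
  have := ExteriorAlgebra.liftAlternating_apply_ιMulti
    (Function.update (0 : ∀ i, V [⋀^Fin i]→ₗ[ℂ] ℂ) n b.det) b
  rw [h, map_zero, Function.update_self, b.det_self] at this
  exact zero_ne_one this

/-- A two-form which only involves linear forms of a subspace of dimension `< 2 m` has zero
`m`-th power. -/
theorem pow_eq_zero_of_finrank_lt [FiniteDimensional ℂ V] (W : Submodule ℂ V) (m : ℕ)
    (hW : finrank ℂ W < 2 * m) {ι' : Type*} (s : Finset ι') (c : ι' → ℂ) (f g : ι' → V)
    (hf : ∀ i, f i ∈ W) (hg : ∀ i, g i ∈ W) :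
    (∑ i ∈ s, c i • (ExteriorAlgebra.ι ℂ (f i) * ExteriorAlgebra.ι ℂ (g i))) ^ m = 0 := by
  -- The form is the image of an element `t` of degree two over `W`; its `m`-th power has degree `2
  -- m`, where the exterior power of `W` is zero.
  let t : ExteriorAlgebra ℂ W := ∑ i ∈ s, c i •
    (ExteriorAlgebra.ι ℂ (⟨f i, hf i⟩ : W) * ExteriorAlgebra.ι ℂ (⟨g i, hg i⟩ : W))
  have ht : ExteriorAlgebra.map W.subtype t =
      ∑ i ∈ s, c i • (ExteriorAlgebra.ι ℂ (f i) * ExteriorAlgebra.ι ℂ (g i)) := by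
    simp [t]
  have ht2 : t ∈ ⋀[ℂ]^2 W := by
    refine Submodule.sum_mem _ fun i _ => Submodule.smul_mem _ _ ?_
    rw [ExteriorAlgebra.exteriorPower, pow_two]
    exact Submodule.mul_mem_mul ⟨_, rfl⟩ ⟨_, rfl⟩
  have htm : t ^ m ∈ ⋀[ℂ]^(2 * m) W := by
    rw [ExteriorAlgebra.exteriorPower, pow_mul]
    exact Submodule.pow_mem_pow _ ht2 m
  have h0 : finrank ℂ (⋀[ℂ]^(2 * m) W) = 0 := by
    rw [exteriorPower.finrank_eq, Nat.choose_eq_zero_of_lt hW]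
  rw [Submodule.finrank_eq_zero.mp h0, Submodule.mem_bot] at htm
  rw [← ht, ← map_pow, htm, map_zero]

end Exterior

/-- The summand is symmetric in `i, j`, since both of its factors change sign, and it is zero on the
diagonal. In the full double sum a vector of the radical can be contracted with either index. -/
theorem d_eq_half_sum {n : ℕ} (C : StructureConstants n) (hC : ∀ x, bracket C x x = 0)
    (ω : Dual ℂ (Fin n → ℂ)) :
    (2 : ℂ) • d C ω = ∑ i, ∑ j, ω (bracket C (Pi.single i 1) (Pi.single j 1)) •
      (oneForm (coordForm i) * oneForm (coordForm j)) := by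
  set g : Fin n → Fin n → Forms n := fun i j => ω (bracket C (Pi.single i 1) (Pi.single j 1)) •
      (oneForm (coordForm i) * oneForm (coordForm j)) with hg
  have hsymm (i j : Fin n) : g i j = g j i := by
    simp only [hg]
    rw [bracket_swap C hC, oneForm, oneForm, ι_mul_ι_comm, map_neg, neg_smul, smul_neg, neg_neg]
  have hdiag (i : Fin n) : g i i = 0 := by simp [hg, hC]
  have hsplit (i : Fin n) : ∑ j, g i j = ∑ j ∈ Finset.Ioi i, g i j + ∑ j ∈ Finset.Iio i, g i j := by
    rw [← Finset.sum_union (Finset.disjoint_left.mpr fun j h1 h2 => by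
      rw [Finset.mem_Ioi] at h1; rw [Finset.mem_Iio] at h2; exact lt_asymm h1 h2)]
    refine (Finset.sum_subset (Finset.subset_univ _) fun j _ hj => ?_).symm
    have : i = j := by
      rcases lt_trichotomy i j with h | h | h
      · simp [h] at hj
      · exact h
      · simp [h] at hj
    rw [← this, hdiag]
  have hswap : ∑ i, ∑ j ∈ Finset.Iio i, g i j = ∑ i, ∑ j ∈ Finset.Ioi i, g i j := by
    rw [Finset.sum_comm' (t' := Finset.univ) (s' := fun j => Finset.Ioi j) (by simp)]
    exact Finset.sum_congr rfl fun i _ => Finset.sum_congr rfl fun j _ => hsymm _ _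
  change (2 : ℂ) • ∑ i, ∑ j ∈ Finset.Ioi i, g i j = ∑ i, ∑ j, g i j
  rw [Finset.sum_congr rfl fun i _ => hsplit i, Finset.sum_add_distrib, hswap, two_smul]

theorem eq_sum_single {n : ℕ} (v : Fin n → ℂ) : v = ∑ i, v i • Pi.single i (1 : ℂ) := by
  ext k; simp [Pi.single_apply]

/-- If `(dω)^p ≠ 0` in dimension `2 p`, then `dω` is nondegenerate. -/
theorem nondegenerate_of_d_pow_ne_zero {p : ℕ} (C : StructureConstants (2 * p))
    (hC : ∀ x, bracket C x x = 0) (ω : Dual ℂ (Fin (2 * p) → ℂ)) (h : d C ω ^ p ≠ 0)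
    (v : Fin (2 * p) → ℂ) (hv : ∀ y, ω (bracket C v y) = 0) : v = 0 := by
  by_contra hv0
  obtain ⟨i₀, hi₀⟩ := Function.ne_iff.mp hv0
  rw [Pi.zero_apply] at hi₀
  apply h
  let W : Submodule ℂ (Dual ℂ (Fin (2 * p) → ℂ)) := LinearMap.ker (Dual.eval ℂ _ v)
  have hWmem (η : Dual ℂ (Fin (2 * p) → ℂ)) : η ∈ W ↔ η v = 0 := Iff.rfl
  have hWrank : finrank ℂ W < 2 * p := by
    have : finrank ℂ (Dual ℂ (Fin (2 * p) → ℂ)) = 2 * p := by simp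
    refine (Submodule.finrank_lt fun htop => ?_).trans_eq this
    have : coordForm i₀ ∈ W := htop ▸ Submodule.mem_top
    exact hi₀ ((hWmem _).mp this)
  let B (i j : Fin (2 * p)) : ℂ := ω (bracket C (Pi.single i 1) (Pi.single j 1))
  -- Subtracting a multiple of the form of index `i₀` moves each coordinate form into the
  -- annihilator `W` of `v`. The two-form is unchanged: the corrections are contractions of `B` with
  -- `v`, which vanish.
  let η (i : Fin (2 * p)) : Dual ℂ (Fin (2 * p) → ℂ) := coordForm i - (v i / v i₀) • coordForm i₀
  have hη (i) : η i ∈ W := by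
    rw [hWmem]; simp [η, coordForm, div_mul_cancel₀ _ hi₀]
  have hB1 (j) : ∑ i, v i * B i j = 0 := by
    have := hv (Pi.single j 1)
    rw [eq_sum_single v] at this
    simpa [← bracketLin_apply, B] using this
  have hB2 (i) : ∑ j, v j * B i j = 0 := by
    rw [← neg_eq_zero, ← Finset.sum_neg_distrib, ← hB1 i]
    refine Finset.sum_congr rfl fun j _ => ?_
    simp only [B]
    rw [bracket_swap C hC (Pi.single i 1), map_neg, mul_neg]
  have key : (2 : ℂ) • d C ω = ∑ t : Fin (2 * p) × Fin (2 * p), B t.1 t.2 •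
      (ExteriorAlgebra.ι ℂ (η t.1) * ExteriorAlgebra.ι ℂ (η t.2)) := by
    rw [d_eq_half_sum C hC, Fintype.sum_prod_type]
    have e1 : ∑ i, ∑ j, (B i j * v i) • (oneForm (coordForm i₀) * oneForm (coordForm j) :
        Forms (2 * p)) = 0 := by
      rw [Finset.sum_comm]
      refine Finset.sum_eq_zero fun j _ => ?_
      rw [← Finset.sum_smul, Finset.sum_congr rfl fun i _ => mul_comm _ _, hB1, zero_smul]
    have e2 : ∑ i, ∑ j, (B i j * v j) • (oneForm (coordForm i) * oneForm (coordForm i₀) :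
        Forms (2 * p)) = 0 := by
      refine Finset.sum_eq_zero fun j _ => ?_
      rw [← Finset.sum_smul, Finset.sum_congr rfl fun i _ => mul_comm _ _, hB2, zero_smul]
    have e3 (i j) : B i j • (ExteriorAlgebra.ι ℂ (η i) * ExteriorAlgebra.ι ℂ (η j)) =
        B i j • (oneForm (coordForm i) * oneForm (coordForm j))
        - (v i₀)⁻¹ • ((B i j * v i) • (oneForm (coordForm i₀) * oneForm (coordForm j)))
        - (v i₀)⁻¹ • ((B i j * v j) • (oneForm (coordForm i) * oneForm (coordForm i₀))) := by
      simp only [η, map_sub, map_smul, sub_mul, mul_sub, smul_sub,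
        ExteriorAlgebra.ι_sq_zero, smul_zero, sub_zero, smul_smul, smul_mul_assoc, mul_smul_comm,
        oneForm, div_eq_mul_inv]
      module
    simp only [e3, Finset.sum_sub_distrib, ← Finset.smul_sum]
    rw [e1, e2]
    simp [B]
  have h2 : ((2 : ℂ) • d C ω) ^ p = 0 := by
    rw [key]
    exact pow_eq_zero_of_finrank_lt W p hWrank _ _ _ _ (fun t => hη t.1) fun t => hη t.2
  rw [smul_pow] at h2
  exact (smul_eq_zero.mp h2).resolve_left (pow_ne_zero _ two_ne_zero)

/-- The form `ω₁` works: `dω₁` is a sum of `p` commuting products of square zero, so its `p`-th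
power is `p!` times the product of all the coordinate forms. -/
theorem frobeniusModel_isFrobeniusian (p : ℕ) (hp : 1 ≤ p) (φ : Fin (p - 1) → ℂ) :
    IsFrobeniusian (frobeniusModel p φ) := by
  refine ⟨coordForm ⟨0, by omega⟩, fun h => ?_, ?_⟩
  · have := LinearMap.congr_fun h (Pi.single ⟨0, by omega⟩ 1)
    simp at this
  · let f : ℕ → Forms (2 * p) := fun i => if h : i < 2 * p then oneForm (coordForm ⟨i, h⟩) else 0
    have hf (i : ℕ) : ∃ x, f i = ExteriorAlgebra.ι ℂ x := by
      by_cases h : i < 2 * p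
      · exact ⟨coordForm ⟨i, h⟩, by simp [f, h]⟩
      · exact ⟨0, by simp [f, h]⟩
    have hd : d (frobeniusModel p φ) (coordForm ⟨0, by omega⟩) =
        ∑ k ∈ Finset.range p, f (2 * k) * f (2 * k + 1) := by
      refine (frobeniusModel_maurerCartan p hp φ).1.trans ?_
      dsimp only
      obtain ⟨q, rfl⟩ : ∃ q, p = q + 1 := ⟨p - 1, by omega⟩
      rw [Finset.sum_range_succ', Finset.sum_range]
      refine (add_comm _ _).trans (congrArg₂ _ ?_ ?_)
      · refine Finset.sum_congr rfl fun k _ => ?_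
        have := k.2
        simp only [f]
        rw [dif_pos (by omega), dif_pos (by omega)]
        rfl
      · simp only [f]
        rw [dif_pos (by omega), dif_pos (by omega)]
    rw [hd, (sum_pow_of_commute_of_sq_eq_zero (fun k => f (2 * k) * f (2 * k + 1)) ?_ ?_ p).2,
      ← prod_map_range_two_mul]
    · have : ((List.range (2 * p)).map f).prod = ExteriorAlgebra.ιMulti ℂ (2 * p)
          (Pi.basisFun ℂ (Fin (2 * p))).dualBasis := by
        rw [ExteriorAlgebra.ιMulti_apply]
        congr 1
        refine List.ext_getElem (by simp) fun i h1 h2 => ?_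
        have hi : i < 2 * p := by simpa using h1
        simp only [List.getElem_map, List.getElem_range, List.getElem_ofFn, f, dif_pos hi]
        congr 1
        refine (Pi.basisFun ℂ (Fin (2 * p))).ext fun j => ?_
        simp [Pi.single_apply, eq_comm]
      rw [this, ← Nat.cast_smul_eq_nsmul ℂ]
      refine smul_ne_zero (Nat.cast_ne_zero.mpr (Nat.factorial_ne_zero p)) (ιMulti_basis_ne_zero _)
    · intro i j
      obtain ⟨a, ha⟩ := hf (2 * i)
      obtain ⟨b, hb⟩ := hf (2 * i + 1)
      obtain ⟨a', ha'⟩ := hf (2 * j)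
      obtain ⟨b', hb'⟩ := hf (2 * j + 1)
      simp only [ha, hb, ha', hb']
      exact commute_ι_mul_ι _ _ _ _
    · intro i
      obtain ⟨a, ha⟩ := hf (2 * i)
      obtain ⟨b, hb⟩ := hf (2 * i + 1)
      simp only [ha, hb]
      exact ι_mul_ι_sq _ _

/-! ### Simultaneous reduction of a symplectic form and a second bilinear form -/

section Symplectic

universe u

variable {W : Type u} [AddCommGroup W] [Module ℂ W]

theorem alternating_swap {σ : W →ₗ[ℂ] W →ₗ[ℂ] ℂ} (hσ : ∀ x, σ x x = 0) (x y : W) :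
    σ y x = -σ x y := by
  have h := hσ (x + y)
  simp only [map_add, LinearMap.add_apply, hσ] at h
  linear_combination h

/-- The vectors `u i`, `w i` form a symplectic basis for `σ`, in which the matrix of `β` is zero
on the pairs `(u i, u j)` and lower triangular on the pairs `(u i, w j)`. -/
structure IsAdaptedBasis (σ β : W →ₗ[ℂ] W →ₗ[ℂ] ℂ) {q : ℕ} (u w : Fin q → W) : Prop where
  left_right : ∀ i j, σ (u i) (w j) = if i = j then 1 else 0
  left_left : ∀ i j, σ (u i) (u j) = 0
  right_right : ∀ i j, σ (w i) (w j) = 0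
  total : ∀ x, (∀ i, σ x (u i) = 0) → (∀ i, σ x (w i) = 0) → x = 0
  form_left_left : ∀ i j, β (u i) (u j) = 0
  form_left_right : ∀ i j, i < j → β (u i) (w j) = 0

/-- The orthogonal of a hyperbolic pair. -/
def orthogonalPair (σ : W →ₗ[ℂ] W →ₗ[ℂ] ℂ) (v z : W) : Submodule ℂ W :=
  LinearMap.ker (σ v) ⊓ LinearMap.ker (σ z)

theorem mem_orthogonalPair {σ : W →ₗ[ℂ] W →ₗ[ℂ] ℂ} {v z x : W} :
    x ∈ orthogonalPair σ v z ↔ σ v x = 0 ∧ σ z x = 0 := by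
  simp [orthogonalPair]

/-- Any `y` can be projected to the orthogonal of the pair by adding a combination of `v` and `z`,
which does not alter `σ x y` when `x` is itself orthogonal to both. -/
theorem nondegenerate_orthogonalPair {σ : W →ₗ[ℂ] W →ₗ[ℂ] ℂ} (hσ : ∀ x, σ x x = 0)
    (hnd : ∀ x, (∀ y, σ x y = 0) → x = 0) {v z : W} (hvz : σ v z = 1)
    (x : W) (hx : x ∈ orthogonalPair σ v z) (h : ∀ y ∈ orthogonalPair σ v z, σ x y = 0) :
    x = 0 := by
  refine hnd x fun y => ?_
  rw [mem_orthogonalPair] at hx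
  have hzv : σ z v = -1 := by rw [alternating_swap hσ v z, hvz]
  have hy := h (y + σ z y • v - σ v y • z) (by
    rw [mem_orthogonalPair]
    constructor <;> simp [hσ, hvz, hzv])
  simp only [map_sub, map_add, map_smul, alternating_swap hσ v x, alternating_swap hσ z x, hx.1,
    hx.2, neg_zero, smul_zero, add_zero, sub_zero] at hy
  exact hy

/-- Induction on the dimension. An eigenvector `v` of `σ⁻¹ β` satisfies `β v = a • σ v`, and the
relation between `β` and its transpose makes `β(·, v)` proportional to `σ v` too. With `σ v z = 1`,
both forms vanish on the orthogonal of `(v, z)`, so `v` and `z` can be put in front of an adapted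
basis of that orthogonal, where the same hypotheses hold with the same `c`. -/
theorem exists_isAdaptedBasis (n : ℕ) : ∀ (W : Type u) [AddCommGroup W] [Module ℂ W]
    [FiniteDimensional ℂ W], finrank ℂ W = n → ∀ (σ β : W →ₗ[ℂ] W →ₗ[ℂ] ℂ) (c : ℂ),
    (∀ x, σ x x = 0) → (∀ x, (∀ y, σ x y = 0) → x = 0) →
    (∀ x y, β x y = β y x + c * σ x y) →
    ∃ (q : ℕ) (u w : Fin q → W), IsAdaptedBasis σ β u w := by
  induction n using Nat.strong_induction_on with
  | _ n ih =>
  intro W _ _ _ hn σ β c hσ hnd hβ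
  rcases subsingleton_or_nontrivial W with hW | hW
  · exact ⟨0, Fin.elim0, Fin.elim0, by
      constructor <;> intro x <;> first | exact x.elim0 | exact fun _ _ => Subsingleton.elim _ _⟩
  have hinj : Function.Injective σ := by
    rw [injective_iff_map_eq_zero]
    exact fun x hx => hnd x fun y => by rw [hx, LinearMap.zero_apply]
  let e : W ≃ₗ[ℂ] Dual ℂ W :=
    LinearMap.linearEquivOfInjective σ hinj Subspace.dual_finrank_eq.symm
  obtain ⟨a, ha⟩ := Module.End.exists_eigenvalue (e.symm.toLinearMap ∘ₗ β)
  obtain ⟨v, hv⟩ := ha.exists_hasEigenvector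
  have hv0 : v ≠ 0 := hv.2
  have hva (y : W) : β v y = a * σ v y := by
    have h1 : e.symm (β v) = a • v := hv.apply_eq_smul
    have h2 : β v = a • σ v := by
      rw [LinearEquiv.symm_apply_eq] at h1
      rw [h1, map_smul]
      rfl
    rw [h2]; rfl
  obtain ⟨z, hvz⟩ : ∃ z, σ v z = 1 := by
    by_contra hcon
    refine hv0 (hnd v fun y => ?_)
    by_contra hy
    exact hcon ⟨(σ v y)⁻¹ • y, by rw [map_smul, smul_eq_mul, inv_mul_cancel₀ hy]⟩
  let U := orthogonalPair σ v z
  have hU : finrank ℂ U < n := by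
    refine (Submodule.finrank_lt fun htop => ?_).trans_eq hn
    have : z ∈ U := htop ▸ Submodule.mem_top
    rw [mem_orthogonalPair, hvz] at this
    exact one_ne_zero this.1
  obtain ⟨q, u, w, H⟩ := ih _ hU U rfl (σ.domRestrict₁₂ U U) (β.domRestrict₁₂ U U) c
    (fun x => hσ x)
    (fun x hx => Subtype.ext <| nondegenerate_orthogonalPair hσ hnd hvz x x.2
      fun y hy => hx ⟨y, hy⟩)
    (fun x y => hβ x y)
  have hmem (x : U) : σ v x = 0 ∧ σ z x = 0 := mem_orthogonalPair.mp x.2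
  have hmem' (x : U) : σ x v = 0 ∧ σ x z = 0 := by
    rw [alternating_swap hσ v, alternating_swap hσ z, (hmem x).1, (hmem x).2]; simp
  have hβv (x : W) : β x v = (a - c) * σ v x := by
    rw [hβ, hva, alternating_swap hσ v x]; ring
  refine ⟨q + 1, Fin.cons v fun i => u i, Fin.cons z fun i => w i, ?_, ?_, ?_, ?_, ?_, ?_⟩
  · intro i j
    refine Fin.cases ?_ (fun i => ?_) i <;> refine Fin.cases ?_ (fun j => ?_) j
    · simpa using hvz
    · simpa [Fin.succ_ne_zero, eq_comm] using (hmem (w j)).1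
    · simpa [Fin.succ_ne_zero] using (hmem' (u i)).2
    · simpa [Fin.succ_inj, LinearMap.domRestrict₁₂_apply] using H.left_right i j
  · intro i j
    refine Fin.cases ?_ (fun i => ?_) i <;> refine Fin.cases ?_ (fun j => ?_) j
    · exact hσ v
    · exact (hmem (u j)).1
    · exact (hmem' (u i)).1
    · exact H.left_left i j
  · intro i j
    refine Fin.cases ?_ (fun i => ?_) i <;> refine Fin.cases ?_ (fun j => ?_) j
    · exact hσ z
    · exact (hmem (w j)).2
    · exact (hmem' (w i)).2
    · exact H.right_right i j
  · intro x hxu hxw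
    have hxU : x ∈ U := by
      rw [mem_orthogonalPair, alternating_swap hσ x, alternating_swap hσ x]
      exact ⟨neg_eq_zero.mpr (hxu 0), neg_eq_zero.mpr (hxw 0)⟩
    exact congrArg Subtype.val (H.total ⟨x, hxU⟩ (fun i => hxu i.succ) fun i => hxw i.succ)
  · intro i j
    refine Fin.cases ?_ (fun i => ?_) i <;> refine Fin.cases ?_ (fun j => ?_) j
    · simp [hva, hσ]
    · simp [hva, (hmem (u j)).1]
    · simp [hβv, (hmem (u i)).1]
    · exact H.form_left_left i j
  · intro i j
    refine Fin.cases ?_ (fun i => ?_) i <;> refine Fin.cases ?_ (fun j => ?_) j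
    · simp
    · simp [hva, (hmem (w j)).1]
    · intro h; simp at h
    · intro h; exact H.form_left_right i j (Fin.succ_lt_succ_iff.mp h)

end Symplectic

open Filter Topology

/-! ### Diagonal contractions -/

/-- The structure constant `c`, scaled by `t ^ (m - k)`, tends to `c₀` as `t → 0`. -/
def HasContractionLimit (c c₀ : ℂ) (m k : ℕ) : Prop :=
  (c = c₀ ∧ (m = k ∨ c₀ = 0)) ∨ (c₀ = 0 ∧ k < m)

/-- A one-parameter family of changes of basis `b i ↦ t ^ wt i • b i` whose structure constants
tend to those of `C₀` as `t → 0`. -/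
theorem metricContractsTo_of_weights {n : ℕ} {ι : Type*} [Fintype ι] [DecidableEq ι]
    (C C₀ : StructureConstants n) (e : ι ≃ Fin n) (b : Basis ι ℂ (Fin n → ℂ)) (wt : ι → ℕ)
    (h : ∀ i j k, HasContractionLimit (b.repr (bracket C (b i) (b j)) k) (C₀ (e i, e j, e k))
      (wt i + wt j) (wt k)) :
    MetricContractsTo C C₀ := by
  let g (t : ℂ) : StructureConstants n := fun s =>
    (t ^ wt (e.symm s.2.2))⁻¹ * (t ^ wt (e.symm s.1) * t ^ wt (e.symm s.2.1)) *
      b.repr (bracket C (b (e.symm s.1)) (b (e.symm s.2.1))) (e.symm s.2.2)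
  have hlim : Tendsto g (𝓝[≠] 0) (𝓝 C₀) := by
    rw [tendsto_pi_nhds]
    rintro ⟨i, j, k⟩
    obtain ⟨i, rfl⟩ := e.surjective i
    obtain ⟨j, rfl⟩ := e.surjective j
    obtain ⟨k, rfl⟩ := e.surjective k
    simp only [g, Equiv.symm_apply_apply]
    rcases h i j k with ⟨h1, h2 | h2⟩ | ⟨h1, h2⟩
    · refine tendsto_const_nhds.congr' ?_
      filter_upwards [self_mem_nhdsWithin] with t ht
      rw [← pow_add, h2, inv_mul_cancel₀ (pow_ne_zero _ ht), one_mul, h1]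
    · rw [h1, h2]; simp
    · obtain ⟨m, hm⟩ := Nat.exists_eq_add_of_lt h2
      rw [h1]
      have : Tendsto (fun t : ℂ => t ^ (m + 1) * b.repr (bracket C (b i) (b j)) k) (𝓝[≠] 0)
          (𝓝 0) := by
        have hc : Continuous fun t : ℂ => t ^ (m + 1) * b.repr (bracket C (b i) (b j)) k := by
          fun_prop
        simpa using (hc.tendsto 0).mono_left nhdsWithin_le_nhds
      refine this.congr' ?_
      filter_upwards [self_mem_nhdsWithin] with t ht
      rw [← pow_add, hm, add_assoc, pow_add _ (wt k), inv_mul_cancel_left₀ (pow_ne_zero _ ht)]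
  refine mem_closure_of_tendsto hlim ?_
  filter_upwards [self_mem_nhdsWithin] with t ht'
  have ht : t ≠ 0 := ht'
  let b' := (b.unitsSMul fun i => Units.mk0 t ht ^ wt i).reindex e
  refine ⟨b'.equivFun.symm, ?_⟩
  ext ⟨i, j, k⟩
  have hb' (i : Fin n) : b'.equivFun.symm (Pi.single i 1) = t ^ wt (e.symm i) • b (e.symm i) := by
    rw [Basis.equivFun_symm_apply, Finset.sum_eq_single i]
    · simp [b', Basis.unitsSMul_apply, Units.smul_def]
    · intro j _ hj; simp [hj]
    · simp
  simp only [act, g, LinearEquiv.symm_symm, hb', Basis.equivFun_apply]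
  simp only [← bracketLin_apply, map_smul, LinearMap.smul_apply, b']
  simp [Units.smul_def]
  ring

/-- Totality makes `LinearMap.pi κ` injective and biorthogonality makes it surjective, so its
inverse is the basis. -/
theorem exists_basis_of_biorthogonal {V ι : Type*} [AddCommGroup V] [Module ℂ V] [Fintype ι]
    [DecidableEq ι] (b : ι → V) (κ : ι → Dual ℂ V)
    (h : ∀ i j, κ i (b j) = if i = j then 1 else 0) (htot : ∀ x, (∀ i, κ i x = 0) → x = 0) :
    ∃ B : Basis ι ℂ V, (∀ i, B i = b i) ∧ ∀ x k, B.repr x k = κ k x := by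
  have hb (i : ι) : LinearMap.pi κ (b i) = Pi.single i 1 := by
    ext k; simp [h, Pi.single_apply]
  have hbij : Function.Bijective (LinearMap.pi κ) := by
    refine ⟨(injective_iff_map_eq_zero _).mpr fun x hx => htot x fun i => congrFun hx i,
      fun y => ⟨∑ i, y i • b i, ?_⟩⟩
    rw [map_sum]
    ext k
    simp [h]
  let E := LinearEquiv.ofBijective _ hbij
  refine ⟨Basis.ofEquivFun E, fun i => ?_, fun x k => by simp [E]⟩
  rw [Basis.coe_ofEquivFun, LinearEquiv.symm_apply_eq]
  exact (hb i).symm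

/-! ### Frobenius bases and the contraction onto the model -/

/-- The bilinear form `dω`, as a bilinear map. -/
def dForm {n : ℕ} (C : StructureConstants n) (ω : Dual ℂ (Fin n → ℂ)) :
    (Fin n → ℂ) →ₗ[ℂ] (Fin n → ℂ) →ₗ[ℂ] ℂ := (bracketLin C).compr₂ ω

@[simp] theorem dForm_apply {n : ℕ} (C : StructureConstants n) (ω : Dual ℂ (Fin n → ℂ))
    (x y : Fin n → ℂ) : dForm C ω x y = ω (bracket C x y) := rfl

theorem pairModel_swap {q : ℕ} (φ : Fin q → ℂ) (i j k : PairIndex q) :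
    pairModel φ j i k = -pairModel φ i j k := by
  rcases i with (_ | _) | (i | i) <;> rcases j with (_ | _) | (j | j) <;>
    rcases k with (_ | _) | (k | k) <;> simp [pairModel] <;> grind

theorem pairModel_self {q : ℕ} (φ : Fin q → ℂ) (i k : PairIndex q) : pairModel φ i i k = 0 := by
  have := pairModel_swap φ i i k
  linear_combination this / 2

/-- Weights of the basis vectors in the contraction onto a member of the family. -/
def contractionWeight {q : ℕ} : PairIndex q → ℕ
  | .inl false => 6 * q + 2
  | .inl true => 0
  | .inr (.inl i) => 2 * q + 1 + i
  | .inr (.inr i) => 4 * q + 1 - i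

/-- The family made of a hyperbolic pair and of an adapted basis of its orthogonal. -/
def pairVector {V : Type*} {q : ℕ} (e₁ e₂ : V) (u w : Fin q → V) : PairIndex q → V
  | .inl false => e₁
  | .inl true => e₂
  | .inr (.inl i) => u i
  | .inr (.inr i) => w i

/-- A basis adapted to the symplectic form `σ = dω`: the vector `e₂` represents `ω`, the pair
`(e₁, e₂)` is hyperbolic, and `u`, `w` is a symplectic basis of its orthogonal, in which the
bilinear form `σ ([e₂, x], y)` is triangular. -/
structure IsFrobeniusBasis {n : ℕ} (C : StructureConstants n) (ω : Dual ℂ (Fin n → ℂ)) {q : ℕ}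
    (e₁ e₂ : Fin n → ℂ) (u w : Fin q → Fin n → ℂ) : Prop where
  form_eq : ∀ x, ω x = dForm C ω x e₂
  hyperbolic : dForm C ω e₁ e₂ = 1
  fst_left : ∀ i, dForm C ω e₁ (u i) = 0
  fst_right : ∀ i, dForm C ω e₁ (w i) = 0
  snd_left : ∀ i, dForm C ω e₂ (u i) = 0
  snd_right : ∀ i, dForm C ω e₂ (w i) = 0
  left_right : ∀ i j, dForm C ω (u i) (w j) = if i = j then 1 else 0
  left_left : ∀ i j, dForm C ω (u i) (u j) = 0
  right_right : ∀ i j, dForm C ω (w i) (w j) = 0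
  total : ∀ x, dForm C ω x e₁ = 0 → dForm C ω x e₂ = 0 → (∀ i, dForm C ω x (u i) = 0) →
    (∀ i, dForm C ω x (w i) = 0) → x = 0
  swap : ∀ x y, dForm C ω (bracket C e₂ x) y = dForm C ω (bracket C e₂ y) x - dForm C ω x y
  form_left_left : ∀ i j, dForm C ω (bracket C e₂ (u i)) (u j) = 0
  form_left_right : ∀ i j, i < j → dForm C ω (bracket C e₂ (u i)) (w j) = 0

theorem exists_isFrobeniusBasis {p : ℕ} (C : StructureConstants (2 * p))
    (hC : C ∈ lieVariety (2 * p)) (hF : IsFrobeniusian C) :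
    ∃ (ω : Dual ℂ (Fin (2 * p) → ℂ)) (q : ℕ) (e₁ e₂ : Fin (2 * p) → ℂ)
      (u w : Fin q → Fin (2 * p) → ℂ), IsFrobeniusBasis C ω e₁ e₂ u w := by
  obtain ⟨ω, hω, hpow⟩ := hF
  obtain ⟨hself, hjac⟩ := hC
  set σ := dForm C ω
  have hσ (x) : σ x x = 0 := by simp [σ, hself]
  have hnd (x) (hx : ∀ y, σ x y = 0) : x = 0 :=
    nondegenerate_of_d_pow_ne_zero C hself ω hpow x hx
  have hinj : Function.Injective σ := by
    rw [injective_iff_map_eq_zero]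
    exact fun x hx => hnd x fun y => by rw [hx, LinearMap.zero_apply]
  -- The sign is chosen so that `ω x = σ x e₂`, with `e₂` in the second place.
  obtain ⟨e₂, he₂⟩ := (LinearMap.linearEquivOfInjective σ hinj
    Subspace.dual_finrank_eq.symm).surjective (-ω)
  have hωσ (x) : ω x = σ x e₂ := by
    rw [alternating_swap hσ e₂, show σ e₂ = -ω from he₂, LinearMap.neg_apply, neg_neg]
  obtain ⟨e₁, he₁⟩ : ∃ e₁, ω e₁ = 1 := by
    by_contra hcon
    refine hω (LinearMap.ext fun y => ?_)
    by_contra hy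
    exact hcon ⟨(ω y)⁻¹ • y, by rw [map_smul, smul_eq_mul, inv_mul_cancel₀ hy]⟩
  have h12 : σ e₁ e₂ = 1 := by rw [← hωσ, he₁]
  set β := σ.comp (bracketLin C e₂)
  -- Apply `ω` to the Jacobi identity of `e₂, x, y`; the middle term `ω [[x, y], e₂]` is `ω [x, y]`,
  -- by the choice of `e₂`.
  have hβ (x y) : β x y = β y x + (-1) * σ x y := by
    have h := congrArg ω (hjac e₂ x y)
    have h1 := hωσ (bracket C x y)
    have h2 : bracket C y e₂ = -bracket C e₂ y := bracket_swap C hself _ _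
    rw [h2, ← bracketLin_apply C (-_), map_neg] at h
    simp only [map_add, LinearMap.neg_apply, map_neg, bracketLin_apply, map_zero] at h
    simp only [β, LinearMap.comp_apply, σ, dForm_apply, bracketLin_apply] at h1 ⊢
    linear_combination h + h1
  let U := orthogonalPair σ e₁ e₂
  obtain ⟨q, u, w, H⟩ := exists_isAdaptedBasis _ U rfl (σ.domRestrict₁₂ U U)
    (β.domRestrict₁₂ U U) (-1) (fun x => hσ x)
    (fun x hx => Subtype.ext <| nondegenerate_orthogonalPair hσ hnd h12 x x.2
      fun y hy => hx ⟨y, hy⟩)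
    (fun x y => hβ x y)
  have hU (x : U) : σ e₁ x = 0 ∧ σ e₂ x = 0 := mem_orthogonalPair.mp x.2
  refine ⟨ω, q, e₁, e₂, fun i => u i, fun i => w i, ?_⟩
  exact
    { form_eq := hωσ
      hyperbolic := h12
      fst_left := fun i => (hU _).1
      fst_right := fun i => (hU _).1
      snd_left := fun i => (hU _).2
      snd_right := fun i => (hU _).2
      left_right := H.left_right
      left_left := H.left_left
      right_right := H.right_right
      total := fun x h1 h2 hu hw => by
        have hxU : x ∈ U := by
          rw [mem_orthogonalPair, alternating_swap hσ x, alternating_swap hσ x]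
          exact ⟨neg_eq_zero.mpr h1, neg_eq_zero.mpr h2⟩
        exact congrArg Subtype.val (H.total ⟨x, hxU⟩ hu hw)
      swap := fun x y => (hβ x y).trans (by
        simp only [β, LinearMap.comp_apply, bracketLin_apply]; ring)
      form_left_left := H.form_left_left
      form_left_right := H.form_left_right }

/-- The linear forms dual to a Frobenius basis. -/
def pairForm {n : ℕ} (C : StructureConstants n) (ω : Dual ℂ (Fin n → ℂ)) {q : ℕ}
    (e₁ e₂ : Fin n → ℂ) (u w : Fin q → Fin n → ℂ) : PairIndex q → Dual ℂ (Fin n → ℂ)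
  | .inl false => (dForm C ω).flip e₂
  | .inl true => dForm C ω e₁
  | .inr (.inl i) => (dForm C ω).flip (w i)
  | .inr (.inr i) => dForm C ω (u i)

section

variable {n q : ℕ} {C : StructureConstants n} {ω : Dual ℂ (Fin n → ℂ)}
  {e₁ e₂ : Fin n → ℂ} {u w : Fin q → Fin n → ℂ}

theorem pairForm_center (x : Fin n → ℂ) :
    pairForm C ω e₁ e₂ u w (.inl false) x = dForm C ω x e₂ := by
  rw [pairForm, LinearMap.flip_apply]

theorem pairForm_left (i : Fin q) (x : Fin n → ℂ) :
    pairForm C ω e₁ e₂ u w (.inr (.inl i)) x = dForm C ω x (w i) := by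
  rw [pairForm, LinearMap.flip_apply]

theorem pairForm_right (i : Fin q) (x : Fin n → ℂ) :
    pairForm C ω e₁ e₂ u w (.inr (.inr i)) x = dForm C ω (u i) x := by
  rw [pairForm]

theorem dForm_self (hself : ∀ x, bracket C x x = 0) (ω : Dual ℂ (Fin n → ℂ)) (x : Fin n → ℂ) :
    dForm C ω x x = 0 := by simp [hself]

theorem IsFrobeniusBasis.exists_basis (H : IsFrobeniusBasis C ω e₁ e₂ u w)
    (hself : ∀ x, bracket C x x = 0) :
    ∃ B : Basis (PairIndex q) ℂ (Fin n → ℂ), (∀ i, B i = pairVector e₁ e₂ u w i) ∧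
      ∀ x k, B.repr x k = pairForm C ω e₁ e₂ u w k x := by
  have hσ := dForm_self hself ω
  have hsw {x y} (h : dForm C ω x y = 0) : dForm C ω y x = 0 := by
    rw [alternating_swap hσ x, h, neg_zero]
  refine exists_basis_of_biorthogonal _ _ ?_ fun x hx => ?_
  · rintro ((_ | _) | (i | i)) ((_ | _) | (j | j)) <;>
      simp [pairVector, pairForm, -dForm_apply, hσ, H.hyperbolic, H.fst_left, H.fst_right,
        hsw (H.fst_left _), hsw (H.snd_left _), hsw (H.snd_right _), H.snd_right,
        H.left_right, H.left_left, H.right_right, eq_comm]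
  · exact H.total x (hsw (hx (.inl true))) (hx (.inl false)) (fun i => hsw (hx (.inr (.inr i))))
      fun i => hx (.inr (.inl i))

/-- The weights satisfy `wt e₂ = 0` and `wt e₁ = wt (u i) + wt (w i)`, so the constants of the model
do not move. Two vectors among the `u, w` have total weight at least `4 q + 2`, above that of any
single one, so their brackets keep only the `e₁` component, which is given by `σ`. Weights increase
along `u` and decrease along `w`, with every `w` above every `u`: under `ad e₂` the components that
would not tend to zero are the diagonal ones and those that vanish by triangularity. -/
theorem IsFrobeniusBasis.hasContractionLimit (H : IsFrobeniusBasis C ω e₁ e₂ u w)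
    (hself : ∀ x, bracket C x x = 0) (i j k : PairIndex q) :
    HasContractionLimit (pairForm C ω e₁ e₂ u w k
        (bracket C (pairVector e₁ e₂ u w i) (pairVector e₁ e₂ u w j)))
      (pairModel (fun i => dForm C ω (bracket C e₂ (u i)) (w i)) i j k)
      (contractionWeight i + contractionWeight j) (contractionWeight k) := by
  have hσ := dForm_self hself ω
  revert k
  set φ : Fin q → ℂ := fun i => dForm C ω (bracket C e₂ (u i)) (w i)
  set b := pairVector e₁ e₂ u w
  set κ := pairForm C ω e₁ e₂ u w with hκ
  let P (i j k : PairIndex q) : Prop :=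
    HasContractionLimit (κ k (bracket C (b i) (b j))) (pairModel φ i j k)
      (contractionWeight i + contractionWeight j) (contractionWeight k)
  have hzero {i j k} (h : κ k (bracket C (b i) (b j)) = 0) (h' : pairModel φ i j k = 0) : P i j k :=
    Or.inl ⟨h.trans h'.symm, Or.inr h'⟩
  have hlt {i j k} (h' : pairModel φ i j k = 0)
      (h : contractionWeight k < contractionWeight i + contractionWeight j) : P i j k :=
    Or.inr ⟨h', h⟩
  have hsymm {i j} (h : ∀ k, P i j k) (k) : P j i k := by
    have := h k
    simp only [P, HasContractionLimit] at this ⊢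
    rwa [bracket_swap C hself (b i), map_neg, pairModel_swap, neg_inj, neg_eq_zero,
      add_comm (contractionWeight j)]
  have hκu (j) (x) : κ (.inr (.inl j)) (bracket C e₂ x) = dForm C ω (bracket C e₂ x) (w j) :=
    pairForm_left j _
  have hκw (j) (x) : κ (.inr (.inr j)) (bracket C e₂ x) = -dForm C ω (bracket C e₂ x) (u j) := by
    rw [hκ, pairForm_right, alternating_swap hσ]
  have hκ1 (x y) : κ (.inl false) (bracket C x y) = dForm C ω x y := by
    rw [hκ, pairForm_center, ← H.form_eq, dForm_apply]
  have P12 (k) : P (.inl false) (.inl true) k := by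
    rcases k with (_ | _) | (k | k)
    · exact Or.inl ⟨(hκ1 _ _).trans H.hyperbolic, Or.inl rfl⟩
    all_goals exact hlt rfl (by simp only [contractionWeight]; omega)
  have P1u (i k) : P (.inl false) (.inr (.inl i)) k := by
    rcases k with (_ | _) | (k | k)
    · exact hzero ((hκ1 _ _).trans (H.fst_left i)) rfl
    all_goals exact hlt rfl (by simp only [contractionWeight]; omega)
  have P1w (i k) : P (.inl false) (.inr (.inr i)) k := by
    rcases k with (_ | _) | (k | k)
    · exact hzero ((hκ1 _ _).trans (H.fst_right i)) rfl
    all_goals exact hlt rfl (by simp only [contractionWeight]; omega)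
  have P2u (i k) : P (.inl true) (.inr (.inl i)) k := by
    rcases k with (_ | _) | (k | k)
    · exact hzero ((hκ1 _ _).trans (H.snd_left i)) rfl
    · exact hlt rfl (by simp only [contractionWeight]; omega)
    · rcases lt_trichotomy i k with h | rfl | h
      · exact hzero ((hκu _ _).trans (H.form_left_right i k h)) (if_neg h.ne)
      · exact Or.inl ⟨(hκu _ _).trans (if_pos rfl).symm, Or.inl (zero_add _)⟩
      · exact hlt (if_neg h.ne') (by simp only [contractionWeight]; omega)
    · exact hzero ((hκw _ _).trans (neg_eq_zero.mpr (H.form_left_left i k))) rfl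
  have P2w (i k) : P (.inl true) (.inr (.inr i)) k := by
    rcases k with (_ | _) | (k | k)
    · exact hzero ((hκ1 _ _).trans (H.snd_right i)) rfl
    · exact hlt rfl (by simp only [contractionWeight]; omega)
    · exact hlt rfl (by simp only [contractionWeight]; omega)
    · have hval : κ (.inr (.inr k)) (bracket C e₂ (w i)) =
          -(dForm C ω (bracket C e₂ (u k)) (w i) + if k = i then 1 else 0) := by
        rw [hκw, H.swap, alternating_swap hσ (u k), H.left_right]; split_ifs <;> ring
      rcases lt_trichotomy k i with h | rfl | h
      · refine hzero (hval.trans ?_) (if_neg h.ne')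
        rw [if_neg h.ne, H.form_left_right k i h, add_zero, neg_zero]
      · refine Or.inl ⟨hval.trans ?_, Or.inl (zero_add _)⟩
        simp only [pairModel, if_true, φ]
        ring
      · exact hlt (if_neg h.ne) (by simp only [contractionWeight]; omega)
  have Puu (i j k) : P (.inr (.inl i)) (.inr (.inl j)) k := by
    rcases k with (_ | _) | (k | k)
    · exact hzero ((hκ1 _ _).trans (H.left_left i j)) rfl
    all_goals exact hlt rfl (by simp only [contractionWeight]; omega)
  have Pww (i j k) : P (.inr (.inr i)) (.inr (.inr j)) k := by
    rcases k with (_ | _) | (k | k)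
    · exact hzero ((hκ1 _ _).trans (H.right_right i j)) rfl
    all_goals exact hlt rfl (by simp only [contractionWeight]; omega)
  have Puw (i j k) : P (.inr (.inl i)) (.inr (.inr j)) k := by
    rcases k with (_ | _) | (k | k)
    · refine Or.inl ⟨(hκ1 _ _).trans (H.left_right i j), ?_⟩
      rcases eq_or_ne i j with rfl | h
      · left; simp only [contractionWeight]; omega
      · exact Or.inr (if_neg h)
    all_goals exact hlt rfl (by simp only [contractionWeight]; omega)
  rcases i with (_ | _) | (i | i) <;> rcases j with (_ | _) | (j | j)
  · exact fun k => hzero (by rw [hself, map_zero]) (pairModel_self φ _ k)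
  · exact P12
  · exact P1u j
  · exact P1w j
  · exact hsymm P12
  · exact fun k => hzero (by rw [hself, map_zero]) (pairModel_self φ _ k)
  · exact P2u j
  · exact P2w j
  · exact hsymm (P1u i)
  · exact hsymm (P2u i)
  · exact Puu i j
  · exact Puw i j
  · exact hsymm (P1w i)
  · exact hsymm (P2w i)
  · exact hsymm (Puw j i)
  · exact Pww i j

end

theorem exists_metricContractsTo_frobeniusModel {p : ℕ} (hp : 1 ≤ p)
    (C : StructureConstants (2 * p)) (hC : C ∈ lieVariety (2 * p)) (hF : IsFrobeniusian C) :
    ∃ φ, MetricContractsTo C (frobeniusModel p φ) := by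
  obtain ⟨ω, q, e₁, e₂, u, w, H⟩ := exists_isFrobeniusBasis C hC hF
  obtain ⟨B, hB, hBκ⟩ := H.exists_basis hC.1
  obtain rfl : q = p - 1 := by
    have h1 := Module.finrank_eq_card_basis B
    simp at h1
    omega
  refine ⟨fun i => dForm C ω (bracket C e₂ (u i)) (w i),
    metricContractsTo_of_weights C _ (numbering p hp) B contractionWeight fun i j k => ?_⟩
  rw [frobeniusModel_numbering, hBκ, hB, hB]
  exact H.hasContractionLimit hC.1 i j k

/-! ### Comparison of the two notions of contraction -/

/-- Zero sets of polynomials are closed in the usual topology. -/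
theorem MetricContractsTo.contractsTo {n : ℕ} {C C₀ : StructureConstants n}
    (h : MetricContractsTo C C₀) : ContractsTo C C₀ := by
  rw [ContractsTo, MvPolynomial.mem_zeroLocus_iff]
  intro f hf
  rw [MvPolynomial.mem_vanishingIdeal_iff] at hf
  have hclosed : IsClosed {x : StructureConstants n | MvPolynomial.aeval x f = 0} :=
    isClosed_eq (by simpa [MvPolynomial.aeval_eq_eval] using f.continuous_eval) continuous_const
  exact closure_minimal (fun x hx => hf x hx) hclosed h

/-! ### An invariant of the orbit closures -/

/-- The determinant of `s tr (ad x) + r ad x`, a polynomial invariant of the pair `(C, x)`. -/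
def adDet {n : ℕ} (r s : ℂ) (C : StructureConstants n) (x : Fin n → ℂ) : ℂ :=
  LinearMap.det ((s * LinearMap.trace ℂ _ (bracketLin C x)) • (LinearMap.id : (Fin n → ℂ) →ₗ[ℂ] _)
    + r • bracketLin C x)

theorem bracketLin_act {n : ℕ} (f : (Fin n → ℂ) ≃ₗ[ℂ] (Fin n → ℂ)) (C : StructureConstants n)
    (x : Fin n → ℂ) : bracketLin (act f C) x = f.symm.conj (bracketLin C (f x)) := by
  have h : bracketLin (act f C) =
      ((bracketLin C).compl₁₂ f.toLinearMap f.toLinearMap).compr₂ f.symm.toLinearMap := by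
    refine (Pi.basisFun ℂ (Fin n)).ext fun i => (Pi.basisFun ℂ (Fin n)).ext fun j => ?_
    ext k
    simp [bracket_single, act]
  rw [h]
  ext y
  simp [LinearEquiv.conj_apply]

theorem trace_act {n : ℕ} (f : (Fin n → ℂ) ≃ₗ[ℂ] (Fin n → ℂ)) (C : StructureConstants n)
    (x : Fin n → ℂ) : LinearMap.trace ℂ _ (bracketLin (act f C) x) =
      LinearMap.trace ℂ _ (bracketLin C (f x)) := by
  rw [bracketLin_act, LinearMap.trace_conj']

theorem adDet_act {n : ℕ} (r s : ℂ) (f : (Fin n → ℂ) ≃ₗ[ℂ] (Fin n → ℂ))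
    (C : StructureConstants n) (x : Fin n → ℂ) : adDet r s (act f C) x = adDet r s C (f x) := by
  rw [adDet, trace_act, bracketLin_act, ← LinearEquiv.conj_id f.symm, ← map_smul, ← map_smul,
    ← map_add, LinearEquiv.conj_apply, LinearMap.comp_assoc]
  exact LinearMap.det_conj _ f.symm

/-- The generic matrix of `ad x`. -/
def genericAd {n : ℕ} (x : Fin n → ℂ) :
    Matrix (Fin n) (Fin n) (MvPolynomial (Fin n × Fin n × Fin n) ℂ) :=
  Matrix.of fun k j => ∑ i, MvPolynomial.C (x i) * MvPolynomial.X (i, j, k)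

theorem map_genericAd {n : ℕ} (C : StructureConstants n) (x : Fin n → ℂ) :
    (MvPolynomial.aeval C).toRingHom.mapMatrix (genericAd x) =
      LinearMap.toMatrix' (bracketLin C x) := by
  ext k j
  simp [genericAd, LinearMap.toMatrix'_apply, bracket, Pi.single_apply]

/-- An identity `det (s tr (ad x) + r ad x) = a (tr (ad x))ⁿ` passes to the orbit closure. -/
theorem ContractsTo.adDet_eq {n : ℕ} {C C₀ : StructureConstants n} (h : ContractsTo C C₀)
    (r s a : ℂ)
    (hC : ∀ x, adDet r s C x = a * LinearMap.trace ℂ _ (bracketLin C x) ^ n) (x : Fin n → ℂ) :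
    adDet r s C₀ x = a * LinearMap.trace ℂ _ (bracketLin C₀ x) ^ n := by
  let f : MvPolynomial (Fin n × Fin n × Fin n) ℂ :=
    Matrix.det ((MvPolynomial.C s * (genericAd x).trace) • (1 : Matrix (Fin n) (Fin n) _) +
      (MvPolynomial.C r : MvPolynomial (Fin n × Fin n × Fin n) ℂ) • genericAd x) -
      MvPolynomial.C a * (genericAd x).trace ^ n
  have htrace (C' : StructureConstants n) : MvPolynomial.aeval C' (genericAd x).trace =
      LinearMap.trace ℂ _ (bracketLin C' x) := by
    rw [LinearMap.trace_eq_matrix_trace ℂ (Pi.basisFun ℂ (Fin n)), LinearMap.toMatrix_eq_toMatrix',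
      ← map_genericAd]
    exact AddMonoidHom.map_trace (MvPolynomial.aeval C').toRingHom.toAddMonoidHom (genericAd x)
  have hf (C' : StructureConstants n) : MvPolynomial.aeval C' f =
      adDet r s C' x - a * LinearMap.trace ℂ _ (bracketLin C' x) ^ n := by
    simp only [f, map_sub, map_mul, map_pow, htrace, MvPolynomial.aeval_C]
    congr 1
    rw [adDet, ← LinearMap.det_toMatrix', map_add, map_smul, map_smul, LinearMap.toMatrix'_id,
      ← map_genericAd]
    refine (AlgHom.map_det (MvPolynomial.aeval C') _).trans (congrArg Matrix.det ?_)
    ext i j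
    rcases eq_or_ne i j with rfl | hij
    · simp [← htrace, MvPolynomial.aeval_eq_eval]
    · simp [Matrix.one_apply_ne hij]
  -- The vector `x` is fixed in `f`, but the value of `f` at the point of the orbit given by `g`
  -- involves `C` at `g x`; this is why the identity is assumed for all vectors.
  have := h f (by
    rw [MvPolynomial.mem_vanishingIdeal_iff]
    rintro _ ⟨g, rfl⟩
    rw [hf, adDet_act, hC, trace_act, sub_self])
  rw [hf] at this
  exact sub_eq_zero.mp this

theorem det_eq_prod_diag_of_blockTriangular {m α R : Type*} [Fintype m] [DecidableEq m]
    [LinearOrder α] [CommRing R] (M : Matrix m m R) (r : m → α) (hr : Function.Injective r)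
    (h : M.BlockTriangular r) : M.det = ∏ i, M i i := by
  let _ : LinearOrder m := LinearOrder.lift' r hr
  convert Matrix.det_of_isUpperTriangular (M := M) (fun i j hij => h hij)

/-! ### Spectrum of the adjoint operators of the model -/

section Model

variable {p : ℕ} (hp : 1 ≤ p) (φ : Fin (p - 1) → ℂ)

/-- An ordering of the basis of `F_φ` in which the adjoint operators are upper triangular. -/
def triangularOrder {q : ℕ} : PairIndex q → ℕ
  | .inl false => 0
  | .inl true => 2 * q + 1
  | .inr (.inl i) => 2 * i + 1
  | .inr (.inr i) => 2 * i + 2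

theorem triangularOrder_injective {q : ℕ} :
    Function.Injective (triangularOrder : PairIndex q → ℕ) := by
  rintro ((_ | _) | (i | i)) ((_ | _) | (j | j)) h <;> simp [triangularOrder] at h ⊢ <;> omega

/-- The matrix of `ad x` in `F_φ`, with rows and columns indexed by pairs. -/
def adMatrix (x : Fin (2 * p) → ℂ) : Matrix (PairIndex (p - 1)) (PairIndex (p - 1)) ℂ :=
  LinearMap.toMatrix ((Pi.basisFun ℂ _).reindex (numbering p hp).symm)
    ((Pi.basisFun ℂ _).reindex (numbering p hp).symm) (bracketLin (frobeniusModel p φ) x)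

theorem adMatrix_apply (x : Fin (2 * p) → ℂ) (i j : PairIndex (p - 1)) :
    adMatrix hp φ x i j = pairCoord hp (bracket (frobeniusModel p φ) x
      (Pi.single (numbering p hp j) 1)) i := by
  simp [adMatrix, LinearMap.toMatrix_apply, pairCoord]

theorem pairCoord_single (i j : PairIndex (p - 1)) :
    pairCoord hp (Pi.single (numbering p hp j) 1) i = if i = j then 1 else 0 := by
  simp [pairCoord, Pi.single_apply]

/-- The diagonal of `ad x` in `F_φ`, for a vector `x` with coordinate `1` on `e₂`. -/
def adWeight {q : ℕ} (φ : Fin q → ℂ) : PairIndex q → ℂ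
  | .inl false => -1
  | .inl true => 0
  | .inr (.inl i) => φ i
  | .inr (.inr i) => -(1 + φ i)

theorem adMatrix_diag (x : Fin (2 * p) → ℂ) (i : PairIndex (p - 1)) :
    adMatrix hp φ x i i = pairCoord hp x (.inl true) * adWeight φ i := by
  rw [adMatrix_apply]
  rcases i with (_ | _) | (i | i) <;>
    simp [pairCoord_bracket_center, pairCoord_bracket_grading, pairCoord_bracket_left,
      pairCoord_bracket_right, pairCoord_single, adWeight] <;> ring

theorem adMatrix_blockTriangular (x : Fin (2 * p) → ℂ) :
    (adMatrix hp φ x).BlockTriangular triangularOrder := by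
  intro i j hij
  rw [adMatrix_apply]
  rcases i with (_ | _) | (i | i) <;> rcases j with (_ | _) | (j | j) <;>
    simp [pairCoord_bracket_grading, pairCoord_bracket_left,
      pairCoord_bracket_right, pairCoord_single, triangularOrder] at hij ⊢ <;> grind

-- Each pair contributes `φ k - (1 + φ k) = -1`, as does `e₁`, so the trace is independent of `φ`.
include hp in
theorem trace_frobeniusModel (x : Fin (2 * p) → ℂ) :
    LinearMap.trace ℂ _ (bracketLin (frobeniusModel p φ) x) =
      -p * pairCoord hp x (.inl true) := by
  rw [LinearMap.trace_eq_matrix_trace ℂ ((Pi.basisFun ℂ _).reindex (numbering p hp).symm)]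
  change (adMatrix hp φ x).trace = _
  have : ((p - 1 : ℕ) : ℂ) = p - 1 := by simp [Nat.cast_sub hp]
  simp only [Matrix.trace, Matrix.diag_apply, adMatrix_diag, ← Finset.mul_sum]
  simp [adWeight, Finset.sum_add_distrib, this]
  ring

-- As the trace is `-p` times the coordinate on `e₂`, each diagonal entry is the trace times `s -
-- adWeight φ i`; the factor `p` avoids a division. A pair gives `(s - φ k)(s + 1 + φ k) = s(1+s) -
-- φ k (1 + φ k)`.
include hp in
theorem adDet_frobeniusModel (s : ℂ) (x : Fin (2 * p) → ℂ) :
    adDet p s (frobeniusModel p φ) x =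
      (s * (1 + s) * ∏ k, (s * (1 + s) - φ k * (1 + φ k))) *
        LinearMap.trace ℂ _ (bracketLin (frobeniusModel p φ) x) ^ (2 * p) := by
  rw [adDet, ← LinearMap.det_toMatrix ((Pi.basisFun ℂ _).reindex (numbering p hp).symm), map_add,
    map_smul, map_smul, LinearMap.toMatrix_id]
  change ((s * _) • (1 : Matrix _ _ ℂ) + (p : ℂ) • adMatrix hp φ x).det = _
  rw [det_eq_prod_diag_of_blockTriangular _ triangularOrder triangularOrder_injective]
  · have hcard : 2 * p = 2 + 2 * (p - 1) := by omega
    simp only [Matrix.add_apply, Matrix.smul_apply, Matrix.one_apply_eq, adMatrix_diag,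
      trace_frobeniusModel hp, smul_eq_mul, mul_one]
    set y := -(p : ℂ) * pairCoord hp x (.inl true) with hy
    have hpy (a : ℂ) : s * y + p * (pairCoord hp x (.inl true) * a) = y * (s - a) := by
      rw [hy]; ring
    simp only [hpy]
    rw [Finset.prod_mul_distrib, Finset.prod_const, Finset.card_univ]
    have h1 : Fintype.card (PairIndex (p - 1)) = 2 * p := by
      rw [Fintype.card_congr (numbering p hp), Fintype.card_fin]
    rw [h1, mul_comm]
    congr 1
    simp only [Fintype.prod_sum_type, Fintype.prod_bool, adWeight, ← Finset.prod_mul_distrib]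
    congr 1
    · ring
    · exact Finset.prod_congr rfl fun k _ => by ring
  · intro i j hij
    have hne : i ≠ j := fun h => hij.ne' (congrArg triangularOrder h)
    simp [Matrix.one_apply_ne hne, adMatrix_blockTriangular hp φ x hij]

end Model

/-! ### Isomorphisms between members of the family -/

/-- The factor `y`, due to `e₁` and `e₂` in the application, cancels in `ℂ[X]`. Equal multisets of
roots mean fibres of equal size, and bijections between fibres glue to a permutation. -/
theorem exists_perm_of_prod_eq {q : ℕ} (f g : Fin q → ℂ)
    (h : ∀ y, y * ∏ k, (y - f k) = y * ∏ k, (y - g k)) :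
    ∃ τ : Equiv.Perm (Fin q), ∀ k, g (τ k) = f k := by
  open Polynomial in
  have hpoly : (∏ k, (X - C (f k)) : ℂ[X]) = ∏ k, (X - C (g k)) := by
    refine mul_left_cancel₀ (X_ne_zero (R := ℂ)) (Polynomial.funext fun y => ?_)
    simpa [eval_prod] using h y
  have hroots : Finset.univ.val.map f = Finset.univ.val.map g := by
    have := congrArg Polynomial.roots hpoly
    have hr (f : Fin q → ℂ) : (∏ k, (Polynomial.X - Polynomial.C (f k))).roots =
        Finset.univ.val.map f := by
      rw [← Polynomial.roots_multiset_prod_X_sub_C (Finset.univ.val.map f), Multiset.map_map]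
      rfl
    rwa [hr, hr] at this
  have hfiber (c : ℂ) : Nonempty ({a // f a = c} ≃ {b // g b = c}) := by
    refine ⟨Fintype.equivOfCardEq ?_⟩
    have := congrArg (Multiset.count c) hroots
    rw [Multiset.count_map, Multiset.count_map] at this
    rw [Fintype.card_subtype, Fintype.card_subtype]
    simpa [Finset.card_def, Finset.filter_val, eq_comm] using this
  exact ⟨Equiv.ofFiberEquiv fun c => (hfiber c).some, Equiv.ofFiberEquiv_map _⟩

section Iso

variable {p : ℕ} (hp : 1 ≤ p) (φ φ' : Fin (p - 1) → ℂ) (τ : Equiv.Perm (Fin (p - 1)))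

/-- The coordinates of the image of a vector under the isomorphism which permutes the pairs by `τ`,
and exchanges the two members of the pairs whose parameters differ. -/
def permuteCoord (x : PairIndex (p - 1) → ℂ) : PairIndex (p - 1) → ℂ
  | .inl i => x (.inl i)
  | .inr (.inl k) => if φ' k = φ (τ.symm k) then x (.inr (.inl (τ.symm k)))
      else -x (.inr (.inr (τ.symm k)))
  | .inr (.inr k) => if φ' k = φ (τ.symm k) then x (.inr (.inr (τ.symm k)))
      else x (.inr (.inl (τ.symm k)))

/-- The linear map with coordinates `permuteCoord`. -/
def permuteLin : (Fin (2 * p) → ℂ) →ₗ[ℂ] (Fin (2 * p) → ℂ) where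
  toFun x := permuteCoord φ φ' τ (pairCoord hp x) ∘ (numbering p hp).symm
  map_add' x y := by
    ext m
    obtain ⟨((_ | _) | (k | k)), rfl⟩ := (numbering p hp).surjective m <;>
      simp [permuteCoord, pairCoord_add] <;> split_ifs <;> ring
  map_smul' c x := by
    ext m
    obtain ⟨((_ | _) | (k | k)), rfl⟩ := (numbering p hp).surjective m <;>
      simp [permuteCoord, pairCoord]

theorem pairCoord_permuteLin (x : Fin (2 * p) → ℂ) (i : PairIndex (p - 1)) :
    pairCoord hp (permuteLin hp φ φ' τ x) i = permuteCoord φ φ' τ (pairCoord hp x) i := by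
  simp [pairCoord, permuteLin]

theorem permuteLin_injective : Function.Injective (permuteLin hp φ φ' τ) := by
  rw [injective_iff_map_eq_zero]
  intro x hx
  have h (i) : permuteCoord φ φ' τ (pairCoord hp x) i = 0 := by
    rw [← pairCoord_permuteLin, hx]; rfl
  refine pairCoord_injective hp (funext ?_)
  rintro (i | (k | k))
  · exact h (.inl i)
  · have h1 := h (.inr (.inl (τ k)))
    have h2 := h (.inr (.inr (τ k)))
    simp only [permuteCoord, Equiv.symm_apply_apply] at h1 h2
    split_ifs at h1 h2 <;> assumption
  · have h1 := h (.inr (.inl (τ k)))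
    have h2 := h (.inr (.inr (τ k)))
    simp only [permuteCoord, Equiv.symm_apply_apply] at h1 h2
    split_ifs at h1 h2
    · exact h2
    · exact neg_eq_zero.mp h1

-- The value `φ (1 + φ)` determines `φ` up to `φ ↦ -(1 + φ)`. This substitution is realised by
-- exchanging the two vectors of a pair, with one sign to preserve the symplectic form.
include hp in
theorem isomorphic_frobeniusModel (h : ∀ k, φ' (τ k) * (1 + φ' (τ k)) = φ k * (1 + φ k)) :
    Isomorphic (frobeniusModel p φ) (frobeniusModel p φ') := by
  refine ⟨LinearEquiv.ofInjectiveEndo _ (permuteLin_injective hp φ φ' τ), fun x y => ?_⟩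
  simp only [LinearEquiv.coe_ofInjectiveEndo]
  have hφ (k) (hk : ¬ φ' k = φ (τ.symm k)) : φ' k = -(1 + φ (τ.symm k)) := by
    have h1 := h (τ.symm k)
    rw [Equiv.apply_symm_apply] at h1
    have h2 : (φ' k - φ (τ.symm k)) * (φ' k + (1 + φ (τ.symm k))) = 0 := by linear_combination h1
    exact eq_neg_of_add_eq_zero_left ((mul_eq_zero.mp h2).resolve_left (sub_ne_zero.mpr hk))
  refine pairCoord_injective hp (funext ?_)
  rintro ((_ | _) | (k | k)) <;> rw [pairCoord_permuteLin]
  · simp only [pairCoord_bracket_center, pairCoord_permuteLin, permuteCoord]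
    congr 1
    rw [← τ.symm.sum_comp]
    refine Finset.sum_congr rfl fun k _ => ?_
    split_ifs <;> ring
  · simp only [pairCoord_bracket_grading, permuteCoord]
  · simp only [pairCoord_bracket_left, pairCoord_bracket_right, pairCoord_permuteLin, permuteCoord]
    split_ifs with hk
    · rw [hk]
    · rw [hφ k hk]; ring
  · simp only [pairCoord_bracket_left, pairCoord_bracket_right, pairCoord_permuteLin, permuteCoord]
    split_ifs with hk
    · rw [hk]
    · rw [hφ k hk]; ring

end Iso

theorem isomorphic_of_contractsTo_frobeniusModel {p : ℕ} (hp : 1 ≤ p) (φ φ' : Fin (p - 1) → ℂ)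
    (h : ContractsTo (frobeniusModel p φ) (frobeniusModel p φ')) :
    Isomorphic (frobeniusModel p φ) (frobeniusModel p φ') := by
  obtain ⟨τ, hτ⟩ := exists_perm_of_prod_eq (fun k => φ k * (1 + φ k))
    (fun k => φ' k * (1 + φ' k)) fun y => by
    -- Every complex number has the form `s (1 + s)`, by completing the square.
    obtain ⟨s, hs⟩ : ∃ s : ℂ, s * (1 + s) = y := by
      obtain ⟨t, ht⟩ := IsAlgClosed.exists_pow_nat_eq (1 / 4 + y) two_pos
      exact ⟨t - 1 / 2, by linear_combination ht⟩
    -- At `e₂` the trace is `-p ≠ 0`, so its power can be cancelled.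
    have h1 := h.adDet_eq p s _ (adDet_frobeniusModel hp φ s)
      (Pi.single (numbering p hp (.inl true)) 1)
    rw [adDet_frobeniusModel hp φ', hs] at h1
    refine (mul_right_cancel₀ (pow_ne_zero _ ?_) h1).symm
    rw [trace_frobeniusModel hp, pairCoord_single, if_pos rfl, mul_one, neg_ne_zero,
      Nat.cast_ne_zero]
    omega
  exact isomorphic_frobeniusModel hp φ φ' τ hτ

end LieVar

end

theorem mainTheorem1 (p : ℕ) (hp : 1 ≤ p) :
    LieVar.IsIrreducibleModel LieVar.ContractsTo LieVar.IsFrobeniusian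
        (LieVar.frobeniusModel p) ∧
      LieVar.IsIrreducibleModel LieVar.MetricContractsTo LieVar.IsFrobeniusian
        (LieVar.frobeniusModel p) := by
  have hF (φ) : LieVar.frobeniusModel p φ ∈ LieVar.lieVariety (2 * p) ∧
      LieVar.IsFrobeniusian (LieVar.frobeniusModel p φ) :=
    ⟨LieVar.frobeniusModel_mem_lieVariety p hp φ, LieVar.frobeniusModel_isFrobeniusian p hp φ⟩
  refine ⟨⟨hF, fun C hC hC' => ?_, fun φ φ' h h' => ?_⟩,
    ⟨hF, fun C hC hC' => LieVar.exists_metricContractsTo_frobeniusModel hp C hC hC',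
      fun φ φ' h h' => ?_⟩⟩
  · obtain ⟨φ, h⟩ := LieVar.exists_metricContractsTo_frobeniusModel hp C hC hC'
    exact ⟨φ, h.contractsTo⟩
  · exact h (LieVar.isomorphic_of_contractsTo_frobeniusModel hp φ φ' h')
  · exact h (LieVar.isomorphic_of_contractsTo_frobeniusModel hp φ φ' h'.contractsTo)
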